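/- There is an absolute constant $C>0$ such that the following holds. Let $G=(V,E,w)$ be a finite connected simple undirected graph with nonnegative edge weights, given with a planar embedding, and let $d_G(u,v)$ be the minimum total weight of a path between $u$ and $v$. Let $\ell\ge 1$, $d>0$, $\delta>0$, and let $s_1,\dots,s_\ell$ be vertices (not necessarily distinct) that lie on a common face in cyclic order, i.e. they are met in this order during one traversal of the boundary walk of the face. Suppose that $d_G(s_i,s_{i+1})\le d$ for all $1\le i<\ell$, and that $d_G(v,s_1)\le d$ for all $v\in V$ (both hold, for instance, if the weighted diameter of $G$ is at most $d$). Then there is a $\delta$-additive core-set $V'\subseteq V$ with respect to $s_1,\dots,s_\ell$, i.e. a set such that for every $v\in V$ there is $v'\in V'$ with $$|d_G(v,s_i)-d_G(v',s_i)|\le\delta\qquad\text{for all } 1\le i\le \ell,$$ of size $$|V'|\le C\,\ell^6\,\max\{1,d/\delta\}^4 .$$ In particular $|V'|=O(\ell^6(d/\delta)^4)$ whenever $\delta\le d$. -/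

import Mathlib

namespace PlanarCoreSet

/-! ### Weighted distances -/

/-- Total weight of a walk, for edge weights `w`. -/
noncomputable def walkWeight {V : Type*} {G : SimpleGraph V} (w : Sym2 V → ℝ) {u v : V}
    (p : G.Walk u v) : ℝ :=
  (p.edges.map w).sum

/-- The weighted distance: the least total weight of a walk from `u` to `v`. (It is only used for
finite connected graphs with nonnegative weights, where the infimum is attained by a path.) -/
noncomputable def wdist {V : Type*} (G : SimpleGraph V) (w : Sym2 V → ℝ) (u v : V) : ℝ :=
  ⨅ p : G.Walk u v, walkWeight w p

/-! ### Planar embeddings -/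

/-- A rotation system (combinatorial embedding) of a graph: at every vertex `v`, a cyclic order of
the darts (oriented edges) leaving `v`, given by the permutation `next` which sends a dart to its
successor in the order around its tail. -/
structure RotationSystem {V : Type*} (G : SimpleGraph V) where
  next : Equiv.Perm G.Dart
  next_fst : ∀ a : G.Dart, (next a).fst = a.fst
  cyclic : ∀ a b : G.Dart, a.fst = b.fst → next.SameCycle a b

namespace RotationSystem

variable {V : Type*} {G : SimpleGraph V}

/-- Reversal of darts, as a permutation. -/
def dartRev (G : SimpleGraph V) : Equiv.Perm G.Dart :=
  (SimpleGraph.Dart.symm_involutive (G := G)).toPerm SimpleGraph.Dart.symm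

/-- The face-tracing permutation: traverse the dart `u → v`, then leave `v` along the successor of
`v → u` in the rotation at `v`. Its cycles are the facial walks. -/
def faceNext (R : RotationSystem G) : Equiv.Perm G.Dart :=
  (dartRev G).trans R.next

/-- The number of faces: one for each cycle of the face-tracing permutation, and one (with a facial
walk of length zero) for each isolated vertex. -/
noncomputable def numFaces (R : RotationSystem G) : ℕ :=
  Nat.card (Quotient (Equiv.Perm.SameCycle.setoid R.faceNext)) +
    Nat.card {v : V // ∀ u, ¬ G.Adj v u}

/-- A rotation system of a finite connected graph is a planar embedding if it has genus zero, that
is, `|V| - |E| + |F| = 2`. -/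
def IsPlanar (R : RotationSystem G) : Prop :=
  Nat.card V + R.numFaces = Nat.card G.edgeSet + 2

/-- The vertices `s 0, s 1, …` lie on a common face in cyclic order: they are met in this order
during one traversal of the facial walk, which starts at some dart `a` of the face.
(A vertex may occur several times on the facial walk, and repetitions in `s` are allowed.)
The second case is the face around an isolated vertex. -/
def OnCommonFaceInCyclicOrder (R : RotationSystem G) {ℓ : ℕ} (s : Fin ℓ → V) : Prop :=
  (∃ (a : G.Dart) (pos : Fin ℓ → ℕ), Monotone pos ∧
      (∀ i, pos i < Function.minimalPeriod R.faceNext a) ∧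
      ∀ i, s i = ((R.faceNext)^[pos i] a).fst) ∨
    ∃ v : V, (∀ u, ¬ G.Adj v u) ∧ ∀ i, s i = v

end RotationSystem

/-! ### Additive core-sets -/

/-- `u` and `v` are `δ`-additive close with respect to `s`. -/
def AdditiveClose {V : Type*} (G : SimpleGraph V) (w : Sym2 V → ℝ) {ℓ : ℕ} (s : Fin ℓ → V)
    (δ : ℝ) (u v : V) : Prop :=
  ∀ i, |wdist G w u (s i) - wdist G w v (s i)| ≤ δ

/-- `K` is a `δ`-additive core-set with respect to `s`. -/
def IsAdditiveCoreSet {V : Type*} (G : SimpleGraph V) (w : Sym2 V → ℝ) {ℓ : ℕ} (s : Fin ℓ → V)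
    (δ : ℝ) (K : Finset V) : Prop :=
  ∀ v : V, ∃ v' ∈ K, AdditiveClose G w s δ v v'

end PlanarCoreSet

namespace PlanarCoreSet

/-! For vertices `u`, `v` put f(i) = d(u, s_i) - d(v, s_i). If f were low, high, low, high at four
successive positions of the face, join the low positions by near-shortest walks through `u` and the
high ones through `v`. By planarity these walks meet; exchanging their ends at a common vertex
contradicts the gaps in f (`not_alternating`). Hence the increments of f cannot have the signs +, -,
+, - in turn (`not_zigzag`).

Record each vertex by its increments d(v, s_{i+1}) - d(v, s_i), rounded to multiples of δ/(2ℓ). The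
regions below these profiles, inside an ℓ × O(ℓ d/δ) grid, have VC dimension at most 3, so
Sauer-Shelah leaves O((ℓ² max(1, d/δ))³) profiles. The rounded distance to s_1 contributes one more
factor O(max(1, d/δ)). Vertices with equal data are δ-close, so one representative per class
suffices.

The crossing of walks is a discrete Jordan curve theorem, proved by mod 2 homology: genus zero makes
every cycle a boundary of faces (`exists_face_coloring`). -/

open Classical in
/-- A walk on which `g` is invariant under rotation and reversal carries a constant value of `g`. -/
theorem RotationSystem.eq_of_walk {V : Type*} [Finite V] {G : SimpleGraph V}
    (R : RotationSystem G) {A : Type*} (g : G.Dart → A) {u v : V} (p : G.Walk u v)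
    (hnext : ∀ b : G.Dart, b.fst ∈ p.support → g (R.next b) = g b)
    (hsymm : ∀ b : G.Dart, b.fst ∈ p.support → g b.symm = g b)
    (b b' : G.Dart) (hb : b.fst = u) (hb' : b'.fst = v) : g b = g b' := by
  have := Fintype.ofFinite V
  have key : ∀ c c' : G.Dart, c.fst ∈ p.support → c.fst = c'.fst → g c = g c' := by
    intro c c' hc hcc
    obtain ⟨n, -, hn⟩ := (R.cyclic c c' hcc).exists_pow_eq'
    rw [← hn]
    have : ∀ m : ℕ, ((R.next ^ m) c).fst = c.fst ∧ g ((R.next ^ m) c) = g c := by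
      intro m
      induction m with
      | zero => simp
      | succ m ih =>
        rw [pow_succ', Equiv.Perm.mul_apply]
        refine ⟨(R.next_fst _).trans ih.1, ?_⟩
        rw [hnext _ (by rw [ih.1]; exact hc), ih.2]
    exact (this n).2.symm
  induction p generalizing b with
  | nil => exact key b b' (by simp [hb]) (hb.trans hb'.symm)
  | @cons u m v h p ih =>
    have h1 : g b = g ⟨(u, m), h⟩ := key _ _ (by simp [hb]) hb
    have h2 : g (SimpleGraph.Dart.symm ⟨(u, m), h⟩) = g ⟨(u, m), h⟩ := hsymm _ (by simp)
    rw [h1, ← h2]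
    refine ih ?_ ?_ _ rfl hb' ?_
    · exact fun b hb => hnext b (by simp [hb])
    · exact fun b hb => hsymm b (by simp [hb])
    · exact fun c c' hc => key c c' (by simp [hc])

/-! ### Mod 2 homology and crossing walks -/

section Homology

open Classical

variable {V : Type*} {G : SimpleGraph V}

/-- The edge underlying a dart. -/
def dartEdge (b : G.Dart) : G.edgeSet := ⟨b.edge, b.edge_mem⟩

theorem dartEdge_eq_iff (b c : G.Dart) : dartEdge b = dartEdge c ↔ b = c ∨ b = c.symm := by
  simp [dartEdge, Subtype.ext_iff, SimpleGraph.dart_edge_eq_iff]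

theorem dartEdge_surjective : Function.Surjective (dartEdge (G := G)) := by
  rintro ⟨e, he⟩
  induction e with
  | _ u v => exact ⟨⟨(u, v), he⟩, rfl⟩

theorem RotationSystem.faceNext_fst (R : RotationSystem G) (b : G.Dart) :
    (R.faceNext b).fst = b.snd :=
  R.next_fst b.symm

theorem RotationSystem.next_eq (R : RotationSystem G) (b : G.Dart) :
    R.next b = R.faceNext b.symm := by
  change _ = R.next b.symm.symm
  rw [SimpleGraph.Dart.symm_symm]

theorem RotationSystem.iterate_faceNext_succ_fst (R : RotationSystem G) (a : G.Dart) (k : ℕ) :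
    (R.faceNext^[k + 1] a).fst = (R.faceNext^[k] a).snd := by
  rw [Function.iterate_succ_apply', R.faceNext_fst]

/-- The two endpoints of an edge, as a mod 2 chain of vertices. -/
noncomputable def edgeEnds (e : G.edgeSet) : V → ZMod 2 :=
  Pi.single (dartEdge_surjective e).choose.fst 1 + Pi.single (dartEdge_surjective e).choose.snd 1

theorem edgeEnds_dartEdge (b : G.Dart) :
    edgeEnds (dartEdge b) = Pi.single b.fst 1 + Pi.single b.snd 1 := by
  unfold edgeEnds
  rcases (dartEdge_eq_iff _ _).1 (dartEdge_surjective (dartEdge b)).choose_spec with h | h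
  · rw [h]
  · rw [h, add_comm]; rfl

/-- The mod 2 chain of edges of a walk. -/
noncomputable def walkChain {u v : V} (p : G.Walk u v) : G.edgeSet → ZMod 2 :=
  (p.darts.map fun b => (Pi.single (dartEdge b) 1 : G.edgeSet → ZMod 2)).sum

theorem walkChain_apply_eq_zero {u v : V} (p : G.Walk u v) (b : G.Dart)
    (hb : b.fst ∉ p.support) : walkChain p (dartEdge b) = 0 := by
  induction p with
  | nil => simp [walkChain]
  | @cons u m v h p ih =>
    have : walkChain (SimpleGraph.Walk.cons h p) =
      Pi.single (dartEdge ⟨(u, m), h⟩) 1 + walkChain p := by simp [walkChain]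
    simp only [SimpleGraph.Walk.support_cons, List.mem_cons, not_or] at hb
    rw [this, Pi.add_apply, ih hb.2, add_zero, Pi.single_apply, if_neg]
    rw [dartEdge_eq_iff]
    rintro (rfl | rfl)
    · exact hb.1 rfl
    · exact hb.2 p.start_mem_support

variable [Fintype V]

/-- The mod 2 chain of edges given by a mod 2 weighting of the darts. -/
noncomputable def dartChain (G : SimpleGraph V) :
    (G.Dart → ZMod 2) →ₗ[ZMod 2] (G.edgeSet → ZMod 2) :=
  Fintype.linearCombination (ZMod 2) fun b => Pi.single (dartEdge b) 1

/-- The mod 2 boundary of a chain of edges. -/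
noncomputable def edgeBoundary (G : SimpleGraph V) :
    (G.edgeSet → ZMod 2) →ₗ[ZMod 2] (V → ZMod 2) :=
  Fintype.linearCombination (ZMod 2) edgeEnds

theorem edgeBoundary_single (b : G.Dart) :
    edgeBoundary G (Pi.single (dartEdge b) 1) = Pi.single b.fst 1 + Pi.single b.snd 1 := by
  simp [edgeBoundary, edgeEnds_dartEdge]

theorem dartChain_apply (g : G.Dart → ZMod 2) (b : G.Dart) :
    dartChain G g (dartEdge b) = g b + g b.symm := by
  have h : ∀ c : G.Dart, (g c • (Pi.single (dartEdge c) 1 : G.edgeSet → ZMod 2)) (dartEdge b) =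
      if c ∈ ({b, b.symm} : Finset G.Dart) then g c else 0 := by
    intro c
    simp only [Pi.smul_apply, Pi.single_apply, smul_eq_mul, mul_ite, mul_one, mul_zero,
      Finset.mem_insert, Finset.mem_singleton]
    congr 1
    rw [eq_comm (a := dartEdge b), dartEdge_eq_iff]
  rw [dartChain, Fintype.linearCombination_apply, Finset.sum_apply, Finset.sum_congr rfl
    (fun c _ => h c), Finset.sum_ite_mem, Finset.univ_inter, Finset.sum_pair b.symm_ne.symm]

theorem zmod_two_fun_add_self {ι : Type*} (x : ι → ZMod 2) : x + x = 0 := by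
  ext i; exact CharTwo.add_self_eq_zero _

theorem edgeBoundary_dartChain (g : G.Dart → ZMod 2) :
    edgeBoundary G (dartChain G g) =
      ∑ b, g b • (Pi.single b.fst 1 + Pi.single b.snd 1 : V → ZMod 2) := by
  simp only [dartChain, Fintype.linearCombination_apply, map_sum, map_smul, edgeBoundary_single]

theorem RotationSystem.edgeBoundary_dartChain_of_invariant (R : RotationSystem G)
    (g : G.Dart → ZMod 2) (hg : ∀ b, g (R.faceNext b) = g b) :
    edgeBoundary G (dartChain G g) = 0 := by
  rw [edgeBoundary_dartChain]
  simp only [smul_add, Finset.sum_add_distrib]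
  have : ∑ b : G.Dart, g b • (Pi.single b.snd 1 : V → ZMod 2) =
      ∑ b : G.Dart, g b • (Pi.single b.fst 1 : V → ZMod 2) := by
    rw [← Equiv.sum_comp R.faceNext fun b : G.Dart => g b • (Pi.single b.fst 1 : V → ZMod 2)]
    refine Finset.sum_congr rfl fun b _ => ?_
    rw [hg, R.faceNext_fst]
  rw [this, zmod_two_fun_add_self]

theorem edgeBoundary_walkChain {u v : V} (p : G.Walk u v) :
    edgeBoundary G (walkChain p) = Pi.single u 1 + Pi.single v 1 := by
  induction p with
  | nil => simp [walkChain, zmod_two_fun_add_self]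
  | @cons u m v h p ih =>
    have : walkChain (SimpleGraph.Walk.cons h p) =
      Pi.single (dartEdge ⟨(u, m), h⟩) 1 + walkChain p := by simp [walkChain]
    rw [this, map_add, ih, edgeBoundary_single]
    have h0 := zmod_two_fun_add_self (Pi.single m 1 : V → ZMod 2)
    calc _ = (Pi.single u 1 + Pi.single v 1 : V → ZMod 2) + (Pi.single m 1 + Pi.single m 1) := by
          abel
      _ = _ := by rw [h0, add_zero]

/-- In a planar embedding, every mod 2 cycle bounds a set of faces. -/
theorem RotationSystem.IsPlanar.exists_face_coloring {R : RotationSystem G} (hR : R.IsPlanar)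
    (hG : G.Connected) (a : G.Dart) (c : G.edgeSet → ZMod 2) (hc : edgeBoundary G c = 0) :
    ∃ h : G.Dart → ZMod 2, (∀ b, h (R.faceNext b) = h b) ∧
      ∀ b, h b + h b.symm = c (dartEdge b) := by
  let F := Quotient (Equiv.Perm.SameCycle.setoid R.faceNext)
  let mk : G.Dart → F := Quotient.mk _
  have hmk : ∀ b, mk (R.faceNext b) = mk b := fun b =>
    Quotient.sound (Equiv.Perm.sameCycle_apply_left.2 (Equiv.Perm.SameCycle.refl _ _))
  let T : (F → ZMod 2) →ₗ[ZMod 2] (G.edgeSet → ZMod 2) :=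
    (dartChain G).comp (LinearMap.funLeft (ZMod 2) (ZMod 2) mk)
  have hT : ∀ h b, T h (dartEdge b) = h (mk b) + h (mk b.symm) := fun h b =>
    dartChain_apply (h ∘ mk) b
  have hle : LinearMap.range T ≤ LinearMap.ker (edgeBoundary G) := by
    rintro _ ⟨h, rfl⟩
    exact R.edgeBoundary_dartChain_of_invariant (h ∘ mk) fun b => by simp [hmk]
  -- A face colouring in the kernel does not change across any edge, so connectivity makes it
  -- constant.
  have hker : LinearMap.ker T ≤ Submodule.span (ZMod 2) {1} := by
    intro h hh
    rw [Submodule.mem_span_singleton]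
    refine ⟨h (mk a), ?_⟩
    ext f
    obtain ⟨b, rfl⟩ : ∃ b, mk b = f := Quotient.exists_rep f
    have hs : ∀ b : G.Dart, h (mk b.symm) = h (mk b) := fun b => by
      have := hT h b
      rw [LinearMap.mem_ker.1 hh] at this
      exact ((CharTwo.add_eq_zero).1 this.symm).symm
    obtain ⟨p⟩ := hG.preconnected a.fst b.fst
    have := R.eq_of_walk (h ∘ mk) p (fun b _ => by
      simp only [Function.comp_apply, R.next_eq, hmk, hs]) (fun b _ => hs b) a b rfl rfl
    simpa using this
  have hsup : LinearMap.range (edgeBoundary G) ⊔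
      Submodule.span (ZMod 2) {(Pi.single a.fst 1 : V → ZMod 2)} = ⊤ := by
    rw [eq_top_iff, ← (Pi.basisFun (ZMod 2) V).span_eq, Submodule.span_le]
    rintro _ ⟨v, rfl⟩
    obtain ⟨p⟩ := hG.preconnected v a.fst
    have h1 := edgeBoundary_walkChain p
    have h2 : (Pi.single v 1 : V → ZMod 2) =
        edgeBoundary G (walkChain p) + Pi.single a.fst 1 := by
      rw [h1, add_assoc, zmod_two_fun_add_self, add_zero]
    rw [Pi.basisFun_apply, h2]
    exact Submodule.add_mem_sup ⟨_, rfl⟩ (Submodule.mem_span_singleton_self _)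
  have hiso : Nat.card {v : V // ∀ u, ¬ G.Adj v u} = 0 := by
    have : Nontrivial V := ⟨a.fst, a.snd, a.adj.ne⟩
    rw [Nat.card_eq_zero]
    refine Or.inl ⟨fun ⟨v, hv⟩ => ?_⟩
    obtain ⟨u, hu⟩ := hG.preconnected.exists_adj_of_nontrivial v
    exact hv u hu
  have hE : Nat.card V + Nat.card F = Nat.card G.edgeSet + 2 := by
    have := hR
    rw [RotationSystem.IsPlanar, RotationSystem.numFaces, hiso] at this
    exact this
  -- `hker` gives dim range T ≥ F - 1, and `hsup` gives dim ker ∂ ≤ E - V + 1. Euler's formula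
  -- equates the two bounds.
  have d1 := T.finrank_range_add_finrank_ker
  have d2 := (edgeBoundary G).finrank_range_add_finrank_ker
  have d3 := Submodule.finrank_mono hker
  have d4 := finrank_span_le_card (R := ZMod 2) ({1} : Set (F → ZMod 2))
  have d5 := finrank_span_le_card (R := ZMod 2) ({(Pi.single a.fst 1 : V → ZMod 2)} : Set _)
  have d6 := Submodule.finrank_add_le_finrank_add_finrank (LinearMap.range (edgeBoundary G))
    (Submodule.span (ZMod 2) {(Pi.single a.fst 1 : V → ZMod 2)})
  rw [hsup, finrank_top] at d6
  simp only [Module.finrank_fintype_fun_eq_card, Set.toFinset_singleton, Finset.card_singleton,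
    ← Nat.card_eq_fintype_card] at d1 d2 d3 d4 d5 d6
  have heq : LinearMap.range T = LinearMap.ker (edgeBoundary G) :=
    Submodule.eq_of_le_of_finrank_le hle (by omega)
  obtain ⟨h, rfl⟩ : c ∈ LinearMap.range T := heq ▸ LinearMap.mem_ker.2 hc
  exact ⟨h ∘ mk, fun b => by simp [hmk], fun b => (hT h b).symm⟩

/-- The mod 2 boundary of a segment of a facial walk. -/
theorem RotationSystem.edgeBoundary_faceSegment (R : RotationSystem G) (a : G.Dart) {m n : ℕ}
    (hmn : m ≤ n) :
    edgeBoundary G (∑ k ∈ Finset.Ico m n, Pi.single (dartEdge (R.faceNext^[k] a)) 1) =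
      Pi.single (R.faceNext^[m] a).fst 1 + Pi.single (R.faceNext^[n] a).fst 1 := by
  induction n, hmn using Nat.le_induction with
  | base => simp [zmod_two_fun_add_self]
  | succ n hmn ih =>
    rw [Finset.sum_Ico_succ_top hmn, map_add, ih, edgeBoundary_single,
      R.iterate_faceNext_succ_fst]
    have h0 := zmod_two_fun_add_self (Pi.single (R.faceNext^[n] a).fst 1 : V → ZMod 2)
    rw [add_assoc, ← add_assoc (Pi.single (R.faceNext^[n] a).fst 1 : V → ZMod 2), h0, zero_add]

/-- Two walks in a planar embedding whose endpoints alternate along a face share a vertex. -/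
theorem RotationSystem.IsPlanar.exists_mem_support_inter {R : RotationSystem G}
    (hR : R.IsPlanar) (hG : G.Connected) (a : G.Dart) {n₁ n₂ n₃ n₄ : ℕ} (h₁₂ : n₁ ≤ n₂)
    (h₂₃ : n₂ ≤ n₃) (h₃₄ : n₃ ≤ n₄) (h₄ : n₄ < Function.minimalPeriod R.faceNext a)
    (p : G.Walk (R.faceNext^[n₁] a).fst (R.faceNext^[n₃] a).fst)
    (q : G.Walk (R.faceNext^[n₂] a).fst (R.faceNext^[n₄] a).fst) :
    ∃ x, x ∈ p.support ∧ x ∈ q.support := by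
  by_contra! hdisj
  replace hdisj : ∀ x, x ∈ q.support → x ∉ p.support := fun x hq hp => hdisj x hp hq
  have h₂₃' : n₂ < n₃ := by
    refine lt_of_le_of_ne h₂₃ ?_
    rintro rfl
    exact hdisj _ q.start_mem_support p.end_mem_support
  have hinj : ∀ i j, i < Function.minimalPeriod R.faceNext a → j < Function.minimalPeriod R.faceNext a →
      R.faceNext^[i] a = R.faceNext^[j] a → i = j := fun i j hi hj hij =>
    Function.iterate_injOn_Iio_minimalPeriod hi hj hij
  -- `t` marks one side of a chord drawn inside the face between the ends of `p`. The chord closes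
  -- `p` to a curve, and `h + t` below tells its two sides apart.
  let t : G.Dart → ZMod 2 := ∑ k ∈ Finset.Ico n₁ n₃, Pi.single (R.faceNext^[k] a) 1
  have htc : dartChain G t = ∑ k ∈ Finset.Ico n₁ n₃, Pi.single (dartEdge (R.faceNext^[k] a)) 1 := by
    simp only [t, map_sum, dartChain, Fintype.linearCombination_apply_single, one_smul]
  have ht : ∀ b, t b = if ∃ k, n₁ ≤ k ∧ k < n₃ ∧ R.faceNext^[k] a = b then 1 else 0 := by
    intro b
    simp only [t, Finset.sum_apply]
    split_ifs with hb
    · obtain ⟨k, hk1, hk3, rfl⟩ := hb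
      rw [Finset.sum_eq_single k]
      · simp
      · intro j hj hjk
        rw [Finset.mem_Ico] at hj
        rw [Pi.single_apply, if_neg]
        exact fun h => hjk (hinj _ _ (by omega) (by omega) h.symm)
      · intro h
        exact absurd (Finset.mem_Ico.2 ⟨hk1, hk3⟩) h
    · refine Finset.sum_eq_zero fun j hj => ?_
      rw [Finset.mem_Ico] at hj
      rw [Pi.single_apply, if_neg]
      exact fun h => hb ⟨j, hj.1, hj.2, h.symm⟩
  have hcyc : edgeBoundary G (walkChain p + dartChain G t) = 0 := by
    rw [map_add, htc, R.edgeBoundary_faceSegment a (h₁₂.trans h₂₃), edgeBoundary_walkChain,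
      zmod_two_fun_add_self]
  obtain ⟨h, hface, hedge⟩ := hR.exists_face_coloring hG a _ hcyc
  -- Along a facial walk `t` can change only at positions `n₁` and `n₃`, whose vertices are the ends
  -- of `p`.
  have htface : ∀ b, (R.faceNext b).fst ∉ p.support → t (R.faceNext b) = t b := by
    intro b hb
    rw [ht, ht]
    refine if_congr ⟨?_, ?_⟩ rfl rfl
    · rintro ⟨k, hk1, hk3, hk⟩
      have hne : n₁ ≠ k := by
        rintro rfl
        exact hb (hk ▸ p.start_mem_support)
      obtain ⟨j, rfl⟩ : ∃ j, k = j + 1 := ⟨k - 1, by omega⟩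
      rw [Function.iterate_succ_apply'] at hk
      exact ⟨j, by omega, by omega, R.faceNext.injective hk⟩
    · rintro ⟨k, hk1, hk3, hk⟩
      have hne : k + 1 ≠ n₃ := by
        rintro rfl
        rw [← hk, ← Function.iterate_succ_apply' R.faceNext k a] at hb
        exact hb p.end_mem_support
      exact ⟨k + 1, by omega, by omega, by rw [Function.iterate_succ_apply', hk]⟩
  have hsymm : ∀ b : G.Dart, b.fst ∈ q.support → h b.symm + t b.symm = h b + t b := by
    intro b hb
    have h1 := hedge b
    rw [Pi.add_apply, walkChain_apply_eq_zero p b (hdisj _ hb), zero_add, dartChain_apply] at h1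
    have h2 : (h b + h b.symm) + (t b + t b.symm) = 0 := by rw [h1, CharTwo.add_self_eq_zero]
    rw [← sub_eq_zero, CharTwo.sub_eq_add, ← h2]
    ring
  have hconst := R.eq_of_walk (fun b => h b + t b) q (fun b hb => by
    rw [R.next_eq, hface, htface, hsymm b hb]
    rw [R.faceNext_fst]
    exact hdisj _ hb) hsymm _ _ rfl rfl
  -- Both ends of `q` lie on the same face, so `h` agrees there, while `t` separates them.
  have hiter : ∀ n, h (R.faceNext^[n] a) = h a := by
    intro n
    induction n with
    | zero => rfl
    | succ n ih => rw [Function.iterate_succ_apply', hface, ih]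
  have e2 : t (R.faceNext^[n₂] a) = 1 := by
    rw [ht, if_pos ⟨n₂, h₁₂, h₂₃', rfl⟩]
  have e4 : t (R.faceNext^[n₄] a) = 0 := by
    rw [ht, if_neg]
    rintro ⟨k, -, hk3, hk⟩
    have := hinj _ _ (by omega) (by omega) hk
    omega
  simp only [hiter, e2, e4] at hconst
  exact one_ne_zero (add_left_cancel hconst)

end Homology

/-! ### Weighted distances and exchange along a face -/

section Distance

variable {V : Type*} {G : SimpleGraph V} {w : Sym2 V → ℝ}

theorem walkWeight_append {u v x : V} (p : G.Walk u v) (q : G.Walk v x) :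
    walkWeight w (p.append q) = walkWeight w p + walkWeight w q := by
  simp [walkWeight, SimpleGraph.Walk.edges_append]

theorem walkWeight_reverse {u v : V} (p : G.Walk u v) :
    walkWeight w p.reverse = walkWeight w p := by
  simp [walkWeight, SimpleGraph.Walk.edges_reverse, List.sum_reverse]

theorem walkWeight_nonneg (hw : ∀ e ∈ G.edgeSet, 0 ≤ w e) {u v : V} (p : G.Walk u v) :
    0 ≤ walkWeight w p := by
  refine List.sum_nonneg fun y hy => ?_
  obtain ⟨e, he, rfl⟩ := List.mem_map.1 hy
  exact hw e (p.edges_subset_edgeSet he)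

theorem wdist_le_walkWeight (hw : ∀ e ∈ G.edgeSet, 0 ≤ w e) {u v : V} (p : G.Walk u v) :
    wdist G w u v ≤ walkWeight w p :=
  ciInf_le ⟨0, by rintro _ ⟨q, rfl⟩; exact walkWeight_nonneg hw q⟩ p

/-- Near-minimal walks replace shortest ones, so attainment of the infimum is never needed. -/
theorem exists_walkWeight_lt (hG : G.Connected) {u v : V} {r : ℝ} (h : wdist G w u v < r) :
    ∃ p : G.Walk u v, walkWeight w p < r := by
  have : Nonempty (G.Walk u v) := hG.preconnected u v
  exact exists_lt_of_ciInf_lt h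

theorem wdist_nonneg (hw : ∀ e ∈ G.edgeSet, 0 ≤ w e) (u v : V) : 0 ≤ wdist G w u v :=
  Real.iInf_nonneg fun p => walkWeight_nonneg hw p

theorem wdist_self (hw : ∀ e ∈ G.edgeSet, 0 ≤ w e) (u : V) : wdist G w u u = 0 :=
  le_antisymm ((wdist_le_walkWeight hw .nil).trans (by simp [walkWeight])) (wdist_nonneg hw u u)

theorem wdist_comm (hw : ∀ e ∈ G.edgeSet, 0 ≤ w e) (hG : G.Connected) (u v : V) :
    wdist G w u v = wdist G w v u := by
  have key : ∀ u v, wdist G w u v ≤ wdist G w v u := fun u v => by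
    have : Nonempty (G.Walk v u) := hG.preconnected v u
    refine le_ciInf fun p => ?_
    rw [← walkWeight_reverse]
    exact wdist_le_walkWeight hw _
  exact le_antisymm (key u v) (key v u)

theorem wdist_triangle (hw : ∀ e ∈ G.edgeSet, 0 ≤ w e) (hG : G.Connected) (u v x : V) :
    wdist G w u x ≤ wdist G w u v + wdist G w v x := by
  refine le_of_forall_pos_lt_add fun ε hε => ?_
  obtain ⟨p, hp⟩ := exists_walkWeight_lt (w := w) hG
    (show wdist G w u v < wdist G w u v + ε / 2 by linarith)
  obtain ⟨q, hq⟩ := exists_walkWeight_lt (w := w) hG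
    (show wdist G w v x < wdist G w v x + ε / 2 by linarith)
  have := wdist_le_walkWeight hw (p.append q)
  rw [walkWeight_append] at this
  linarith

theorem abs_wdist_sub_wdist_le (hw : ∀ e ∈ G.edgeSet, 0 ≤ w e) (hG : G.Connected) (v x y : V) :
    |wdist G w v y - wdist G w v x| ≤ wdist G w x y := by
  have h1 := wdist_triangle hw hG v x y
  have h2 := wdist_triangle hw hG v y x
  rw [wdist_comm hw hG y x] at h2
  rw [abs_le]
  constructor <;> linarith

/-- Exchanging the ends of two walks that share a vertex. -/
theorem wdist_add_wdist_le_of_mem_support (hw : ∀ e ∈ G.edgeSet, 0 ≤ w e) (hG : G.Connected)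
    {y u z v x : V} (p : G.Walk y u) (q : G.Walk z v) (hp : x ∈ p.support) (hq : x ∈ q.support) :
    wdist G w u z + wdist G w v y ≤ walkWeight w p + walkWeight w q := by
  classical
  have e1 := congrArg (walkWeight w) (p.take_spec hp)
  have e2 := congrArg (walkWeight w) (q.take_spec hq)
  rw [walkWeight_append] at e1 e2
  have h1 := wdist_triangle hw hG u x z
  have h2 := wdist_triangle hw hG v x y
  have h3 := wdist_le_walkWeight hw (p.dropUntil x hp).reverse
  have h4 := wdist_le_walkWeight hw (p.takeUntil x hp).reverse
  have h5 := wdist_le_walkWeight hw (q.dropUntil x hq).reverse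
  have h6 := wdist_le_walkWeight hw (q.takeUntil x hq).reverse
  rw [walkWeight_reverse] at h3 h4 h5 h6
  linarith

variable [Fintype V] {R : RotationSystem G}

/-- The difference of the distances to two fixed vertices cannot alternate between low and high
values along a face. -/
theorem RotationSystem.IsPlanar.not_alternating (hR : R.IsPlanar) (hG : G.Connected)
    (hw : ∀ e ∈ G.edgeSet, 0 ≤ w e) (a : G.Dart) {n₁ n₂ n₃ n₄ : ℕ} (h₁₂ : n₁ ≤ n₂)
    (h₂₃ : n₂ ≤ n₃) (h₃₄ : n₃ ≤ n₄) (h₄ : n₄ < Function.minimalPeriod R.faceNext a) (u v : V)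
    (f : ℕ → ℝ) (hf : ∀ n, f n =
      wdist G w u (R.faceNext^[n] a).fst - wdist G w v (R.faceNext^[n] a).fst)
    (g₁₂ : f n₁ < f n₂) (g₁₄ : f n₁ < f n₄) (g₃₂ : f n₃ < f n₂) (g₃₄ : f n₃ < f n₄) : False := by
  -- Each walk below exceeds its distance by less than `ε`; an exchange involves two walks, so a gap
  -- of `2 * ε` is contradictory.
  obtain ⟨ε, hε, e₁₂, e₁₄, e₃₂, e₃₄⟩ : ∃ ε : ℝ, 0 < ε ∧ 2 * ε ≤ f n₂ - f n₁ ∧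
      2 * ε ≤ f n₄ - f n₁ ∧ 2 * ε ≤ f n₂ - f n₃ ∧ 2 * ε ≤ f n₄ - f n₃ := by
    refine ⟨min (min (f n₂ - f n₁) (f n₄ - f n₁)) (min (f n₂ - f n₃) (f n₄ - f n₃)) / 2,
      ?_, ?_, ?_, ?_, ?_⟩
    · refine half_pos ?_
      simp only [lt_min_iff, sub_pos]
      exact ⟨⟨g₁₂, g₁₄⟩, g₃₂, g₃₄⟩
    all_goals rw [mul_div_cancel₀ _ two_ne_zero]; simp
  have hwalk : ∀ x y : V, ∃ p : G.Walk x y, walkWeight w p < wdist G w y x + ε := fun x y =>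
    exists_walkWeight_lt hG (by rw [wdist_comm hw hG]; linarith)
  obtain ⟨p₁, hp₁⟩ := hwalk (R.faceNext^[n₁] a).fst u
  obtain ⟨p₃, hp₃⟩ := hwalk (R.faceNext^[n₃] a).fst u
  obtain ⟨q₂, hq₂⟩ := hwalk (R.faceNext^[n₂] a).fst v
  obtain ⟨q₄, hq₄⟩ := hwalk (R.faceNext^[n₄] a).fst v
  obtain ⟨x, hxp, hxq⟩ := hR.exists_mem_support_inter hG a h₁₂ h₂₃ h₃₄ h₄
    (p₁.append p₃.reverse) (q₂.append q₄.reverse)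
  simp only [SimpleGraph.Walk.mem_support_append_iff, SimpleGraph.Walk.support_reverse,
    List.mem_reverse] at hxp hxq
  simp only [hf] at e₁₂ e₁₄ e₃₂ e₃₄
  rcases hxp with hxp | hxp <;> rcases hxq with hxq | hxq <;>
    linarith [wdist_add_wdist_le_of_mem_support (w := w) hw hG _ _ hxp hxq]

/-- Along a face, the difference of the distances to two fixed vertices cannot increase, decrease,
increase and decrease again in turn. -/
theorem RotationSystem.IsPlanar.not_zigzag (hR : R.IsPlanar) (hG : G.Connected)
    (hw : ∀ e ∈ G.edgeSet, 0 ≤ w e) (a : G.Dart) {pos : ℕ → ℕ} (hpos : Monotone pos)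
    (hlt : ∀ i, pos i < Function.minimalPeriod R.faceNext a) (u v : V) (f : ℕ → ℝ)
    (hf : ∀ i, f i = wdist G w u (R.faceNext^[pos i] a).fst -
      wdist G w v (R.faceNext^[pos i] a).fst) {i₁ i₂ i₃ i₄ : ℕ}
    (h₁₂ : i₁ < i₂) (h₂₃ : i₂ < i₃) (h₃₄ : i₃ < i₄) (g₁ : f i₁ < f (i₁ + 1))
    (g₂ : f (i₂ + 1) < f i₂) (g₃ : f i₃ < f (i₃ + 1)) (g₄ : f (i₄ + 1) < f i₄) : False := by
  obtain ⟨z₁, a1, a2, a3, a4⟩ : ∃ z, i₁ + 1 ≤ z ∧ z ≤ i₂ ∧ f (i₁ + 1) ≤ f z ∧ f i₂ ≤ f z := by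
    rcases le_total (f (i₁ + 1)) (f i₂) with h | h
    · exact ⟨i₂, h₁₂, le_rfl, h, le_rfl⟩
    · exact ⟨i₁ + 1, le_rfl, h₁₂, le_rfl, h⟩
  obtain ⟨y₂, b1, b2, b3, b4⟩ : ∃ z, i₂ + 1 ≤ z ∧ z ≤ i₃ ∧ f z ≤ f (i₂ + 1) ∧ f z ≤ f i₃ := by
    rcases le_total (f (i₂ + 1)) (f i₃) with h | h
    · exact ⟨i₂ + 1, le_rfl, h₂₃, le_rfl, h⟩
    · exact ⟨i₃, h₂₃, le_rfl, h, le_rfl⟩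
  obtain ⟨z₂, c1, c2, c3, c4⟩ : ∃ z, i₃ + 1 ≤ z ∧ z ≤ i₄ ∧ f (i₃ + 1) ≤ f z ∧ f i₄ ≤ f z := by
    rcases le_total (f (i₃ + 1)) (f i₄) with h | h
    · exact ⟨i₄, h₃₄, le_rfl, h, le_rfl⟩
    · exact ⟨i₃ + 1, le_rfl, h₃₄, le_rfl, h⟩
  -- The lower outer end completes low-high-low-high on the left; otherwise `i₄ + 1` ends a
  -- high-low-high-low pattern, and swapping `u` and `v` negates `f`.
  rcases le_total (f i₁) (f (i₄ + 1)) with h | h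
  · refine hR.not_alternating hG hw a (hpos (show i₁ ≤ z₁ by omega))
      (hpos (show z₁ ≤ y₂ by omega)) (hpos (show y₂ ≤ z₂ by omega)) (hlt _) u v _
      (fun _ => rfl) ?_ ?_ ?_ ?_ <;> simp only [← hf] <;> linarith
  · refine hR.not_alternating hG hw a (hpos (show z₁ ≤ y₂ by omega))
      (hpos (show y₂ ≤ z₂ by omega)) (hpos (show z₂ ≤ i₄ + 1 by omega)) (hlt _) v u _
      (fun _ => rfl) ?_ ?_ ?_ ?_ <;> rw [← neg_lt_neg_iff] <;>
      simp only [neg_sub, ← hf] <;> linarith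

end Distance

/-! ### VC dimension of rounded profiles -/

section Shattering

open Classical

theorem card_le_of_vcDim_le_three {α : Type*} [Fintype α] [DecidableEq α] {𝒜 : Finset (Finset α)}
    (h : 𝒜.vcDim ≤ 3) : 𝒜.card ≤ (Fintype.card α + 1) ^ 3 := by
  set N := Fintype.card α
  calc 𝒜.card ≤ ∑ k ∈ Finset.Iic 𝒜.vcDim, N.choose k :=
        𝒜.card_le_card_shatterer.trans Finset.card_shatterer_le_sum_vcDim
    _ ≤ ∑ k ∈ Finset.range 4, N.choose k :=
        Finset.sum_le_sum_of_subset fun k hk => by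
          have := Finset.mem_Iic.1 hk
          exact Finset.mem_range.2 (by omega)
    _ ≤ ∑ k ∈ Finset.range 4, N ^ k := Finset.sum_le_sum fun k _ => Nat.choose_le_pow N k
    _ ≤ (N + 1) ^ 3 := by
      simp only [Finset.sum_range_succ, Finset.sum_range_zero]
      nlinarith [sq_nonneg N]

/-- The region below the graph of `n`. -/
noncomputable def subgraphSet (ℓ T : ℕ) (n : ℕ → ℕ) : Finset (Fin ℓ × Fin T) :=
  Finset.univ.filter fun x => (x.2 : ℕ) < n x.1

theorem mem_subgraphSet {ℓ T : ℕ} {n : ℕ → ℕ} {x : Fin ℓ × Fin T} :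
    x ∈ subgraphSet ℓ T n ↔ (x.2 : ℕ) < n x.1 := by
  simp [subgraphSet]

theorem eq_of_subgraphSet_eq {ℓ T : ℕ} {m n : ℕ → ℕ} (hm : ∀ i, m i ≤ T) (hn : ∀ i, n i ≤ T)
    (h : subgraphSet ℓ T m = subgraphSet ℓ T n) {i : ℕ} (hi : i < ℓ) : m i = n i := by
  have key : ∀ m n : ℕ → ℕ, (∀ i, n i ≤ T) → subgraphSet ℓ T m = subgraphSet ℓ T n →
      n i ≤ m i := by
    intro m n hn h
    by_contra! hlt
    have := (Finset.ext_iff.1 h (⟨i, hi⟩, ⟨m i, hlt.trans_le (hn i)⟩)).2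
      (mem_subgraphSet.2 hlt)
    exact lt_irrefl _ (mem_subgraphSet.1 this)
  exact le_antisymm (key n m hm h.symm) (key m n hn h)

/-- Two points in one column are never shattered, since containing the upper forces the lower. Four
shattered points thus have distinct columns, and cutting out the 1st and 3rd by `u`, the 2nd and 4th
by `v`, gives the forbidden alternation. -/
theorem vcDim_subgraphSet_le {V : Type*} [Fintype V] (ℓ T : ℕ) (n : V → ℕ → ℕ)
    (halt : ∀ u v i₁ i₂ i₃ i₄, i₁ < i₂ → i₂ < i₃ → i₃ < i₄ → n v i₁ < n u i₁ → n u i₂ < n v i₂ →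
      n v i₃ < n u i₃ → n u i₄ < n v i₄ → False) :
    (Finset.univ.image fun v => subgraphSet ℓ T (n v)).vcDim ≤ 3 := by
  refine Finset.sup_le fun S hS => ?_
  rw [Finset.mem_shatterer] at hS
  by_contra! hcard
  have htr : ∀ t ⊆ S, ∃ v, ∀ x ∈ S, (x.2 : ℕ) < n v x.1 ↔ x ∈ t := by
    intro t ht
    obtain ⟨X, hX, rfl⟩ := hS ht
    obtain ⟨v, -, rfl⟩ := Finset.mem_image.1 hX
    exact ⟨v, fun x hx => by simp [hx, mem_subgraphSet]⟩
  have hinj : Set.InjOn Prod.fst (S : Set (Fin ℓ × Fin T)) := by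
    have key : ∀ x ∈ S, ∀ y ∈ S, x.1 = y.1 → y.2 ≤ x.2 := by
      intro x hx y hy hxy
      by_contra! hlt
      obtain ⟨v, hv⟩ := htr {y} (Finset.singleton_subset_iff.2 hy)
      have h1 := (hv y hy).2 (Finset.mem_singleton_self y)
      have h2 := Finset.mem_singleton.1
        ((hv x hx).1 (by rw [hxy]; exact lt_trans (Fin.lt_def.1 hlt) h1))
      rw [h2] at hlt
      exact lt_irrefl _ hlt
    intro x hx y hy hxy
    exact Prod.ext hxy (le_antisymm (key y hy x hx hxy.symm) (key x hx y hy hxy))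
  obtain ⟨I, hI, hIc⟩ := Finset.exists_subset_card_eq
    (show 4 ≤ (S.image Prod.fst).card by rw [Finset.card_image_of_injOn hinj]; omega)
  let o := I.orderEmbOfFin hIc
  have hex : ∀ j : Fin 4, ∃ x ∈ S, x.1 = o j := fun j =>
    Finset.mem_image.1 (hI (I.orderEmbOfFin_mem hIc j))
  choose x hxS hx using hex
  have hlt : ∀ j k : Fin 4, j < k → ((x j).1 : ℕ) < (x k).1 := fun j k hjk => by
    rw [hx, hx]; exact o.strictMono hjk
  have hne : ∀ j k : Fin 4, j < k → x j ≠ x k := fun j k hjk h => by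
    have := hlt j k hjk
    rw [h] at this
    exact lt_irrefl _ this
  obtain ⟨u, hu⟩ := htr {x 0, x 2} (by simp [Finset.insert_subset_iff, hxS])
  obtain ⟨v, hv⟩ := htr {x 1, x 3} (by simp [Finset.insert_subset_iff, hxS])
  have n01 := hne 0 1 (by decide)
  have n03 := hne 0 3 (by decide)
  have n12 := hne 1 2 (by decide)
  have n23 := hne 2 3 (by decide)
  have hu0 := (hu _ (hxS 0)).2 (by simp)
  have hu2 := (hu _ (hxS 2)).2 (by simp)
  have hu1 := mt (hu _ (hxS 1)).1 (by simp [n01.symm, n12])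
  have hu3 := mt (hu _ (hxS 3)).1 (by simp [n03.symm, n23.symm])
  have hv1 := (hv _ (hxS 1)).2 (by simp)
  have hv3 := (hv _ (hxS 3)).2 (by simp)
  have hv0 := mt (hv _ (hxS 0)).1 (by simp [n01, n03])
  have hv2 := mt (hv _ (hxS 2)).1 (by simp [n12.symm, n23])
  exact halt u v _ _ _ _ (hlt 0 1 (by decide)) (hlt 1 2 (by decide)) (hlt 2 3 (by decide))
    (by omega) (by omega) (by omega) (by omega)

theorem exists_finset_representatives {V β : Type*} [Fintype V] (key : V → β) (B : Finset β)
    (h : ∀ v, key v ∈ B) : ∃ K : Finset V, K.card ≤ B.card ∧ ∀ v, ∃ v' ∈ K, key v = key v' := by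
  obtain ⟨K, -, hinj, himg⟩ := Finset.exists_subset_injOn_image_eq_of_surjOn (f := key)
    Set.univ (Finset.univ.image key) (by simp [Set.SurjOn])
  refine ⟨K, ?_, fun v => ?_⟩
  · rw [← Finset.card_image_of_injOn hinj, himg]
    exact Finset.card_le_card (Finset.image_subset_iff.2 fun v _ => h v)
  · have : key v ∈ K.image key := himg ▸ Finset.mem_image_of_mem key (Finset.mem_univ v)
    obtain ⟨v', hv', e⟩ := Finset.mem_image.1 this
    exact ⟨v', hv', e.symm⟩

end Shattering

/-! ### Rounding, counting and assembly -/

theorem abs_sub_lt_of_natFloor_div_eq {x y c : ℝ} (hc : 0 < c) (hx : 0 ≤ x) (hy : 0 ≤ y)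
    (h : ⌊x / c⌋₊ = ⌊y / c⌋₊) : |x - y| < c := by
  have h1 := Nat.floor_le (div_nonneg hx hc.le)
  have h2 := Nat.lt_floor_add_one (x / c)
  have h3 := Nat.floor_le (div_nonneg hy hc.le)
  have h4 := Nat.lt_floor_add_one (y / c)
  rw [h] at h1 h2
  have : |x / c - y / c| < 1 := abs_sub_lt_iff.2 ⟨by linarith, by linarith⟩
  rwa [← sub_div, abs_div, abs_of_pos hc, div_lt_one hc] at this

/-- With m = max(1, d/δ), the factors are at most (5ℓ²m)³ and 3m, whence 375 = 5³ · 3. -/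
theorem coreSet_count_le {ℓ : ℕ} (hℓ : 0 < ℓ) {d δ : ℝ} (hd : 0 < d) (hδ : 0 < δ) :
    (((ℓ * ⌊2 * d / (δ / (2 * ℓ))⌋₊ + 1) ^ 3 * (⌊d / (δ / 2)⌋₊ + 1) : ℕ) : ℝ) ≤
      375 * (ℓ : ℝ) ^ 6 * (max 1 (d / δ)) ^ 4 := by
  have hℓ' : (1 : ℝ) ≤ ℓ := by exact_mod_cast hℓ
  have hm1 : 1 ≤ max 1 (d / δ) := le_max_left _ _
  have hmd : d / δ ≤ max 1 (d / δ) := le_max_right _ _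
  generalize max 1 (d / δ) = m at *
  have hT : (⌊2 * d / (δ / (2 * ℓ))⌋₊ : ℝ) ≤ 4 * ℓ * m := by
    calc (⌊2 * d / (δ / (2 * ℓ))⌋₊ : ℝ) ≤ 2 * d / (δ / (2 * ℓ)) := Nat.floor_le (by positivity)
      _ = 4 * ℓ * (d / δ) := by field_simp; ring
      _ ≤ 4 * ℓ * m := by gcongr
  have hB : (⌊d / (δ / 2)⌋₊ : ℝ) ≤ 2 * (d / δ) := by
    calc (⌊d / (δ / 2)⌋₊ : ℝ) ≤ d / (δ / 2) := Nat.floor_le (by positivity)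
      _ = 2 * (d / δ) := by field_simp
  push_cast
  have hB' : (⌊d / (δ / 2)⌋₊ : ℝ) + 1 ≤ 3 * m := by linarith
  have hN : (ℓ : ℝ) * ⌊2 * d / (δ / (2 * ℓ))⌋₊ + 1 ≤ 5 * ℓ ^ 2 * m := by
    have h1 : (ℓ : ℝ) * ⌊2 * d / (δ / (2 * ℓ))⌋₊ ≤ ℓ * (4 * ℓ * m) := by gcongr
    have h2 : 1 ≤ (ℓ : ℝ) ^ 2 * m := one_le_mul_of_one_le_of_one_le (one_le_pow₀ hℓ') hm1
    linarith
  calc _ ≤ (5 * ℓ ^ 2 * m) ^ 3 * (3 * m) := by gcongr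
    _ = 375 * (ℓ : ℝ) ^ 6 * m ^ 4 := by ring

/-- Core-sets for sequences of positions on a face. -/
theorem RotationSystem.IsPlanar.exists_coreSet {V : Type*} [Fintype V] {G : SimpleGraph V}
    {w : Sym2 V → ℝ} {R : RotationSystem G} (hR : R.IsPlanar) (hG : G.Connected)
    (hw : ∀ e ∈ G.edgeSet, 0 ≤ w e) (a : G.Dart) {pos : ℕ → ℕ} (hpos : Monotone pos)
    (hlt : ∀ i, pos i < Function.minimalPeriod R.faceNext a) {ℓ : ℕ} (hℓ : 0 < ℓ) {d δ : ℝ}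
    (hd : 0 < d) (hδ : 0 < δ) (x : ℕ → V) (hx : ∀ i, x i = (R.faceNext^[pos i] a).fst)
    (hstep : ∀ i, wdist G w (x i) (x (i + 1)) ≤ d) (hbase : ∀ v, wdist G w v (x 0) ≤ d) :
    ∃ K : Finset V,
      (∀ v, ∃ v' ∈ K, ∀ i < ℓ, |wdist G w v (x i) - wdist G w v' (x i)| ≤ δ) ∧
      (K.card : ℝ) ≤ 375 * (ℓ : ℝ) ^ 6 * (max 1 (d / δ)) ^ 4 := by
  classical
  have hℓ' : (1 : ℝ) ≤ ℓ := by exact_mod_cast hℓ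
  -- The base distance may cost δ/2, and at most ℓ increments share the other δ/2.
  set η : ℝ := δ / (2 * ℓ) with hη
  have hη0 : 0 < η := by positivity
  let D : V → ℕ → ℝ := fun v i => wdist G w v (x (i + 1)) - wdist G w v (x i)
  have hD : ∀ v i, |D v i| ≤ d := fun v i =>
    (abs_wdist_sub_wdist_le hw hG v (x i) (x (i + 1))).trans (hstep i)
  -- Shifting by `d` puts the increments in [0, 2d], where natural-number floors lose no sign.
  have hD0 : ∀ v i, 0 ≤ D v i + d := fun v i => by linarith [(abs_le.1 (hD v i)).1]
  obtain ⟨n, hn⟩ : ∃ n : V → ℕ → ℕ, ∀ v i, n v i = ⌊(D v i + d) / η⌋₊ := ⟨_, fun _ _ => rfl⟩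
  obtain ⟨T, hT⟩ : ∃ T : ℕ, T = ⌊2 * d / η⌋₊ := ⟨_, rfl⟩
  have hnT : ∀ v i, n v i ≤ T := fun v i => by
    rw [hn, hT]
    apply Nat.floor_mono
    gcongr
    linarith [(abs_le.1 (hD v i)).2]
  -- Strict inequality survives undoing the floor, so alternation of rounded profiles forces true
  -- alternation.
  have hnD : ∀ u v i, n v i < n u i → D v i < D u i := by
    intro u v i h
    by_contra! hle
    rw [hn, hn] at h
    refine absurd h (not_lt.2 (Nat.floor_mono ?_))
    gcongr
  have hvc := vcDim_subgraphSet_le ℓ T n (by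
    intro u v i₁ i₂ i₃ i₄ h₁₂ h₂₃ h₃₄ g₁ g₂ g₃ g₄
    have k₁ := hnD _ _ _ g₁
    have k₂ := hnD _ _ _ g₂
    have k₃ := hnD _ _ _ g₃
    have k₄ := hnD _ _ _ g₄
    simp only [D] at k₁ k₂ k₃ k₄
    refine hR.not_zigzag hG hw a hpos hlt u v (fun i => wdist G w u (x i) - wdist G w v (x i))
      (fun i => by rw [hx]) h₁₂ h₂₃ h₃₄ ?_ ?_ ?_ ?_ <;> linarith)
  have hfam := card_le_of_vcDim_le_three hvc
  obtain ⟨B, hB⟩ : ∃ B : ℕ, B = ⌊d / (δ / 2)⌋₊ := ⟨_, rfl⟩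
  have hBv : ∀ v, ⌊wdist G w v (x 0) / (δ / 2)⌋₊ ≤ B := fun v => by
    rw [hB]
    apply Nat.floor_mono
    gcongr
    exact hbase v
  obtain ⟨K, hKc, hK⟩ := exists_finset_representatives
    (fun v => (subgraphSet ℓ T (n v), ⌊wdist G w v (x 0) / (δ / 2)⌋₊))
    ((Finset.univ.image fun v => subgraphSet ℓ T (n v)) ×ˢ Finset.range (B + 1)) (by
      intro v
      rw [Finset.mem_product, Finset.mem_range]
      exact ⟨Finset.mem_image_of_mem _ (Finset.mem_univ v), Nat.lt_succ_of_le (hBv v)⟩)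
  refine ⟨K, fun v => ?_, ?_⟩
  · obtain ⟨v', hv', e⟩ := hK v
    rw [Prod.mk.injEq] at e
    refine ⟨v', hv', fun i hi => ?_⟩
    have hb := abs_sub_lt_of_natFloor_div_eq (half_pos hδ) (wdist_nonneg hw v (x 0))
      (wdist_nonneg hw v' (x 0)) e.2
    have key : ∀ j ≤ i, |wdist G w v (x j) - wdist G w v' (x j)| ≤ δ / 2 + j * η := by
      intro j hj
      induction j with
      | zero => simpa using hb.le
      | succ j ih =>
        have h1 := abs_sub_lt_of_natFloor_div_eq hη0 (hD0 v j) (hD0 v' j)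
          (by rw [← hn, ← hn]; exact eq_of_subgraphSet_eq (hnT v) (hnT v') e.1 (by omega))
        have h2 := ih (by omega)
        have h3 : wdist G w v (x (j + 1)) - wdist G w v' (x (j + 1)) =
            (wdist G w v (x j) - wdist G w v' (x j)) + ((D v j + d) - (D v' j + d)) := by
          simp only [D]; ring
        rw [h3]
        push_cast
        linarith [abs_add_le (wdist G w v (x j) - wdist G w v' (x j))
          ((D v j + d) - (D v' j + d))]
    have h4 : (i : ℝ) * η ≤ δ / 2 := by
      have : (i : ℝ) ≤ ℓ := by exact_mod_cast hi.le
      calc (i : ℝ) * η ≤ ℓ * η := by gcongr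
        _ = δ / 2 := by rw [hη]; field_simp
    linarith [key i le_rfl]
  · rw [Finset.card_product, Finset.card_range] at hKc
    rw [Fintype.card_prod, Fintype.card_fin, Fintype.card_fin] at hfam
    have hK2 : K.card ≤ (ℓ * T + 1) ^ 3 * (B + 1) := hKc.trans (Nat.mul_le_mul_right _ hfam)
    rw [hT, hB, hη] at hK2
    exact (Nat.cast_le.2 hK2).trans (coreSet_count_le hℓ hd hδ)

end PlanarCoreSet

theorem mainTheorem3 :
    ∃ C : ℝ, 0 < C ∧
      ∀ (V : Type*) [Fintype V] (G : SimpleGraph V) (w : Sym2 V → ℝ)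
        (R : PlanarCoreSet.RotationSystem G) (ℓ : ℕ) (hℓ : 0 < ℓ) (s : Fin ℓ → V) (d δ : ℝ),
        G.Connected →
        (∀ e ∈ G.edgeSet, 0 ≤ w e) →
        R.IsPlanar →
        R.OnCommonFaceInCyclicOrder s →
        0 < d →
        0 < δ →
        (∀ (i : ℕ) (hi : i + 1 < ℓ),
          PlanarCoreSet.wdist G w (s ⟨i, Nat.lt_of_succ_lt hi⟩) (s ⟨i + 1, hi⟩) ≤ d) →
        (∀ v : V, PlanarCoreSet.wdist G w v (s ⟨0, hℓ⟩) ≤ d) →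
        ∃ K : Finset V, PlanarCoreSet.IsAdditiveCoreSet G w s δ K ∧
          (K.card : ℝ) ≤ C * (ℓ : ℝ) ^ 6 * (max 1 (d / δ)) ^ 4 := by
  refine ⟨375, by norm_num, fun V _ G w R ℓ hℓ s d δ hG hw hR hs hd hδ hstep hbase => ?_⟩
  rcases hs with ⟨a, pos, hmono, hlt, hpos⟩ | ⟨v, hv, -⟩
  -- Clamping the index repeats the last vertex forever, so the extra steps have length zero.
  · let c : ℕ → Fin ℓ := fun i => ⟨min i (ℓ - 1), by omega⟩
    have hc : ∀ i : Fin ℓ, c i = i := fun i => Fin.ext (by simp only [c]; omega)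
    have hcm : Monotone c := fun i j hij => Fin.mk_le_mk.2 (by omega)
    obtain ⟨K, hK, hcard⟩ := hR.exists_coreSet hG hw a (hmono.comp hcm) (fun i => hlt (c i)) hℓ
      hd hδ (fun i => s (c i)) (fun i => hpos (c i)) (by
        intro i
        by_cases hi : i + 1 < ℓ
        · have h := hstep i hi
          rwa [← hc ⟨i, Nat.lt_of_succ_lt hi⟩, ← hc ⟨i + 1, hi⟩] at h
        · have : c (i + 1) = c i := Fin.ext (by simp only [c]; omega)
          rw [this, PlanarCoreSet.wdist_self hw]
          exact hd.le) (by
        intro v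
        have h := hbase v
        rwa [← hc ⟨0, hℓ⟩] at h)
    refine ⟨K, fun v => ?_, hcard⟩
    obtain ⟨v', hv', h⟩ := hK v
    refine ⟨v', hv', fun i => ?_⟩
    have := h i i.2
    rwa [hc i] at this
  · have hsub : Subsingleton V := by
      by_contra hns
      rw [not_subsingleton_iff_nontrivial] at hns
      obtain ⟨u, hu⟩ := hG.preconnected.exists_adj_of_nontrivial v
      exact hv u hu
    refine ⟨{v}, fun u => ⟨v, Finset.mem_singleton_self v, fun i => ?_⟩, ?_⟩
    · rw [Subsingleton.elim u v, sub_self, abs_zero]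
      exact hδ.le
    · have h1 : (1 : ℝ) ≤ (ℓ : ℝ) ^ 6 := one_le_pow₀ (by exact_mod_cast hℓ)
      have h2 : (1 : ℝ) ≤ max 1 (d / δ) ^ 4 := one_le_pow₀ (le_max_left _ _)
      rw [Finset.card_singleton, Nat.cast_one]
      nlinarith [one_le_mul_of_one_le_of_one_le h1 h2]
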